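/- **Theorem 5.1.** All vertex operator algebras (VOAs) are over $\mathbb{C}$, are graded by the integral eigenvalues of $L(0)$, and have finite-dimensional homogeneous spaces, which vanish in sufficiently negative weight. We write $Y(u,z)=\sum_{n\in\mathbb{Z}}u(n)z^{-n-1}$. A VOA is *self-dual* if it admits a nonzero bilinear form $(\ ,\ )$ that is invariant, i.e. $(Y(u,z)v,w)=(v,Y(e^{zL(1)}(-z^{-2})^{L(0)}u,z^{-1})w)$; it is of *CFT-type* if its weight zero space is $\mathbb{C}\mathbf{1}$; it is *$\mathbb{N}$-graded* if it has no nonzero states of negative weight. Let $(W,h,V)$ be a *shifted triple*: $W=(W,Y,\mathbf{1},\omega')$ is a self-dual VOA of CFT-type with $Y(\omega',z)=\sum_n L'(n)z^{-n-2}$, $h\in W_1$, and $V=W^h=(W,Y,\mathbf{1},\omega'+L'(-1)h)$ (same space, fields and vacuum) is a simple, self-dual, $\mathbb{N}$-graded VOA. Regard the weight zero space $V_0$ of $V$ as an algebra with product $ab=a(-1)b$. Then $h(0)$ preserves $V_0$. For $\lambda\in\mathbb{C}$ let $A^\lambda=\{v\in V_0 : h(0)v=\lambda v\}$; it coincides with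 $W_{\lambda,\lambda}=\{w\in W : L'(0)w=\lambda w,\ h(0)w=\lambda w\}$. The following hold. 1. $V_0=\bigoplus_{\lambda}A^\lambda$, and if $A^\lambda\neq 0$ then $\lambda$ is a nonnegative integer. 2. $A^0=\mathbb{C}\mathbf{1}$. 3. $h(1)h=\frac{\nu}{2}\mathbf{1}$ for some scalar $\nu\in\mathbb{C}$, and for this $\nu$, $A^\nu=T=\mathbb{C}t$ with $t\ne 0$, where $T$ is the unique minimal nonzero ideal of $V_0$ (it is contained in every nonzero ideal of $V_0$). 4. $A^\lambda(-1)A^\mu\subseteq A^{\lambda+\mu}$ for all $\lambda,\mu$. 5. For every nonzero invariant bilinear form $(\ ,\ )$ on $V$: $(A^\lambda,A^\mu)=0$ if $\lambda+\mu\neq\nu$. 6. For every nonzero invariant bilinear form $(\ ,\ )$ on $V$: if $\lambda+\mu=\nu$, then $(\ ,\ )$ restricts to a perfect pairing $A^\lambda\times A^\mu\to\mathbb{C}$. -/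

import Mathlib

/-- A vertex algebra over `ℂ`: a state-field map `Y` into the vertex operators
(so that `u(n)v = 0` for `n` large, where `u(n)` is the coefficient of `z^(-n-1)` in `Y(u, z)`)
and a vacuum vector, subject to the vacuum, creation and Jacobi (Borcherds) identities. -/
structure VertexAlgebra (V : Type*) [AddCommGroup V] [Module ℂ V] where
  /-- The state-field correspondence `u ↦ Y(u, z)`. -/
  Y : V →ₗ[ℂ] VertexOperator ℂ V
  /-- The vacuum vector. -/
  vac : V
  vacuum : ∀ (n : ℤ) (v : V),
    VertexOperator.ncoeff (Y vac) n v = if n = -1 then v else 0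
  creation : ∀ v : V, VertexOperator.ncoeff (Y v) (-1) vac = v
  creation_nonneg : ∀ (v : V) (n : ℤ), 0 ≤ n → VertexOperator.ncoeff (Y v) n vac = 0
  /-- The Jacobi identity, written in modes; all three sums are finite by truncation. -/
  jacobi : ∀ (u v w : V) (l m n : ℤ),
    (∑ᶠ i : ℕ, Ring.choose m i •
        VertexOperator.ncoeff (Y (VertexOperator.ncoeff (Y u) (l + i) v)) (m + n - i) w) =
      (∑ᶠ i : ℕ, ((-1 : ℤ) ^ i * Ring.choose l i) •
        VertexOperator.ncoeff (Y u) (l + m - i) (VertexOperator.ncoeff (Y v) (n + i) w)) -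
      (∑ᶠ i : ℕ, ((l.negOnePow : ℤ) * (-1 : ℤ) ^ i * Ring.choose l i) •
        VertexOperator.ncoeff (Y v) (l + n - i) (VertexOperator.ncoeff (Y u) (m + i) w))

namespace VertexAlgebra

variable {V : Type*} [AddCommGroup V] [Module ℂ V]

/-- The mode `u(n)`, where `Y(u, z) = ∑ u(n) z^(-n-1)`. -/
noncomputable def mode (U : VertexAlgebra V) (u : V) (n : ℤ) : Module.End ℂ V :=
  VertexOperator.ncoeff (U.Y u) n

/-- The operator `L(n) = ω(n+1)`, i.e. `Y(ω, z) = ∑ L(n) z^(-n-2)`. -/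
noncomputable def vir (U : VertexAlgebra V) (ω : V) (n : ℤ) : Module.End ℂ V :=
  U.mode ω (n + 1)

/-- The space of conformal weight `n`: the `n`-eigenspace of `L(0)`. -/
noncomputable def weightSpace (U : VertexAlgebra V) (ω : V) (n : ℤ) : Submodule ℂ V :=
  Module.End.eigenspace (U.vir ω 0) (n : ℂ)

/-- `(V, Y, 1, ω)` is a vertex operator algebra: the modes of `ω` satisfy the Virasoro relations
for some central charge, `Y(L(-1)v, z)` is the derivative of `Y(v, z)`, and `V` is the direct sum
of the `L(0)`-eigenspaces with integral eigenvalues, which are finite-dimensional and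
vanish for sufficiently negative weight. -/
structure IsVOA (U : VertexAlgebra V) (ω : V) : Prop where
  virasoro : ∃ c : ℂ, ∀ m n : ℤ,
    U.vir ω m * U.vir ω n - U.vir ω n * U.vir ω m =
      ((m : ℂ) - n) • U.vir ω (m + n) +
        (if m + n = 0 then ((m : ℂ) ^ 3 - m) / 12 * c else 0) • (1 : Module.End ℂ V)
  derivative : ∀ (v : V) (n : ℤ), U.mode (U.vir ω (-1) v) n = (-(n : ℂ)) • U.mode v (n - 1)
  grading : DirectSum.IsInternal (U.weightSpace ω)
  finite : ∀ n : ℤ, FiniteDimensional ℂ (U.weightSpace ω n)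
  bounded : ∃ N : ℤ, ∀ n : ℤ, n < N → U.weightSpace ω n = ⊥

/-- Simplicity: `V` is nonzero and has no subspaces invariant under all modes
besides `0` and `V`. -/
def IsSimple (U : VertexAlgebra V) : Prop :=
  Nontrivial V ∧
    ∀ I : Submodule ℂ V, (∀ (u : V) (n : ℤ), ∀ x ∈ I, U.mode u n x ∈ I) → I = ⊥ ∨ I = ⊤

/-- Invariance of a bilinear form with respect to the conformal vector `ω`:
`(Y(u, z)v, w) = (v, Y(e^{zL(1)} (-z⁻²)^{L(0)} u, z⁻¹)w)`.
For `u` of weight `k`, comparing the coefficients of `z^(-n-1)` gives the identity below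
(a finite sum, since `L(1)` lowers weights by one). -/
def IsInvariant (U : VertexAlgebra V) (ω : V) (B : LinearMap.BilinForm ℂ V) : Prop :=
  ∀ (k : ℤ), ∀ u ∈ U.weightSpace ω k, ∀ (n : ℤ) (v w : V),
    B (U.mode u n v) w =
      ∑ᶠ i : ℕ, ((-1 : ℂ) ^ k / (i.factorial : ℂ)) *
        B v (U.mode ((U.vir ω 1 ^ i) u) (2 * k - n - 2 - i) w)

/-- Self-duality: there is a nonzero invariant bilinear form. -/
def IsSelfDual (U : VertexAlgebra V) (ω : V) : Prop :=
  ∃ B : LinearMap.BilinForm ℂ V, B ≠ 0 ∧ U.IsInvariant ω B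

/-- CFT-type: the weight zero space is spanned by the vacuum. -/
def IsCFTType (U : VertexAlgebra V) (ω : V) : Prop :=
  U.weightSpace ω 0 = Submodule.span ℂ {U.vac}

/-- `ℕ`-graded: there are no nonzero states of negative weight. -/
def IsNGraded (U : VertexAlgebra V) (ω : V) : Prop :=
  ∀ n : ℤ, n < 0 → U.weightSpace ω n = ⊥

/-- The shifted vector `ω'_h = ω' + L'(-1)h`. -/
noncomputable def shift (U : VertexAlgebra V) (ω' h : V) : V :=
  ω' + U.vir ω' (-1) h

/-- `(W, h, V)` is a shifted triple, where `W = (U, ω')` and `V = W^h = (U, ω'_h)` share the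
underlying space, the fields and the vacuum. -/
structure IsShiftedTriple (U : VertexAlgebra V) (ω' h : V) : Prop where
  isVOA_W : U.IsVOA ω'
  selfDual_W : U.IsSelfDual ω'
  cftType_W : U.IsCFTType ω'
  mem_W_one : h ∈ U.weightSpace ω' 1
  isVOA_V : U.IsVOA (U.shift ω' h)
  simple_V : U.IsSimple
  selfDual_V : U.IsSelfDual (U.shift ω' h)
  nGraded_V : U.IsNGraded (U.shift ω' h)

/-- `W_{p,q}`: the simultaneous eigenspace `L'(0)w = pw`, `h(0)w = qw`. -/
noncomputable def jointEigenspace (U : VertexAlgebra V) (ω' h : V) (p q : ℂ) : Submodule ℂ V :=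
  Module.End.eigenspace (U.vir ω' 0) p ⊓ Module.End.eigenspace (U.mode h 0) q

/-- `A^p`: the `p`-eigenspace of `h(0)` on the weight zero space `V_0` of `V = W^h`. -/
noncomputable def deRham (U : VertexAlgebra V) (ω' h : V) (p : ℂ) : Submodule ℂ V :=
  U.weightSpace (U.shift ω' h) 0 ⊓ Module.End.eigenspace (U.mode h 0) p

/-- `I` is an ideal of the algebra `V_0` with product `ab = a(-1)b`. -/
def IsZeroIdeal (U : VertexAlgebra V) (ω : V) (I : Submodule ℂ V) : Prop :=
  I ≤ U.weightSpace ω 0 ∧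
    ∀ a ∈ U.weightSpace ω 0, ∀ x ∈ I, U.mode a (-1) x ∈ I ∧ U.mode x (-1) a ∈ I

end VertexAlgebra

/-! The proof identifies `V_0` as a graded commutative Frobenius algebra with socle in degree `ν`.

The Virasoro modes `L'(-1), L'(0), L'(1)` span an `sl₂`, and CFT-type forces `W` to be `ℕ`-graded.
Since `L(0) = L'(0) - h(0)`, the operators `L'(0)` and `h(0)` agree on `V_0`; so `A^p = W_{p,p}`,
and `V_0` inherits from the grading of `W` a grading in nonnegative degrees with `A^0 = ℂ1`.

Products `a(n)b` with `n ≥ 0` of states in `V_0` have negative weight, so `a(-1)b = b(-1)a`, and an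
invariant form satisfies `(a, b) = (1, ab)` on `V_0`. It is nondegenerate there since `V` is simple,
and self-duality of `W` gives `L'(1)h = 0`, so that `L(1)h = -ν1` and `h(0)` has adjoint `ν - h(0)`:
the form pairs `A^p` with `A^{ν-p}`. In particular `A^ν` is a line, dual to `A^0`, and for `k > 0`
`A^{ν+k} = 0`, its dual being `A^{-k}`. Multiplying a nonzero element of an ideal by a state dual to
its component of lowest degree gives a nonzero element of `A^ν`, so every nonzero ideal contains
`A^ν`. -/

section LinearAlgebra

variable {K M : Type*} [Field K] [AddCommGroup M] [Module K M]

lemma mem_of_sum_mem_of_mem_eigenspace {f : Module.End K M} {S : Submodule K M}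
    (hS : ∀ x ∈ S, f x ∈ S) {s : Finset K} {c : K → M} (hc : ∀ a ∈ s, c a ∈ f.eigenspace a)
    (hsum : ∑ a ∈ s, c a ∈ S) : ∀ a ∈ s, c a ∈ S := by
  classical
  induction s using Finset.induction_on generalizing c with
  | empty => simp
  | insert b s hb ih =>
    rw [Finset.forall_mem_insert] at hc
    rw [Finset.sum_insert hb] at hsum
    have hshift : ∑ a ∈ s, (a - b) • c a = f (c b + ∑ a ∈ s, c a) - b • (c b + ∑ a ∈ s, c a) := by
      rw [map_add, map_sum, Module.End.mem_eigenspace_iff.1 hc.1,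
        Finset.sum_congr rfl fun a ha => Module.End.mem_eigenspace_iff.1 (hc.2 a ha)]
      simp only [sub_smul, Finset.sum_sub_distrib, smul_add, Finset.smul_sum]
      abel
    have hs : ∀ a ∈ s, c a ∈ S := fun a ha => by
      have hab : a - b ≠ 0 := sub_ne_zero.2 (ne_of_mem_of_not_mem ha hb)
      refine (Submodule.smul_mem_iff _ hab).1 (ih (c := fun a => (a - b) • c a)
        (fun a ha => Submodule.smul_mem _ _ (hc.2 a ha)) ?_ a ha)
      rw [hshift]
      exact sub_mem (hS _ hsum) (Submodule.smul_mem _ _ hsum)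
    exact Finset.forall_mem_insert _ _ _ |>.2 ⟨(add_mem_cancel_right (sum_mem hs)).1 hsum, hs⟩

lemma iSup_inf_eigenspace_eq_of_mapsTo {f : Module.End K M} (hf : ⨆ a, f.eigenspace a = ⊤)
    {S : Submodule K M} (hS : ∀ x ∈ S, f x ∈ S) : ⨆ a, S ⊓ f.eigenspace a = S := by
  refine le_antisymm (iSup_le fun _ => inf_le_left) fun x hx => ?_
  obtain ⟨c, hc, rfl⟩ :=
    (Submodule.mem_iSup_iff_exists_finsupp _ x).1 (hf ▸ Submodule.mem_top)
  have hcS := mem_of_sum_mem_of_mem_eigenspace hS (fun a _ => hc a) hx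
  exact sum_mem fun a ha => Submodule.mem_iSup_of_mem a ⟨hcS a ha, hc a⟩

lemma exists_sub_mem_iSup_gt {ι : Type*} [LinearOrder ι] (N : ι → Submodule K M) {x : M}
    (hx : x ∈ ⨆ i, N i) (hx0 : x ≠ 0) :
    ∃ i, ∃ y ∈ N i, y ≠ 0 ∧ x - y ∈ ⨆ j > i, N j := by
  obtain ⟨c, hc, rfl⟩ := (Submodule.mem_iSup_iff_exists_finsupp _ _).1 hx
  have hne : c.support.Nonempty := by
    contrapose! hx0
    simp [Finsupp.sum, hx0]
  have hmem := c.support.min'_mem hne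
  set i := c.support.min' hne
  refine ⟨i, c i, hc i, Finsupp.mem_support_iff.1 hmem, ?_⟩
  rw [Finsupp.sum, ← Finset.add_sum_erase _ _ hmem, add_sub_cancel_left]
  exact sum_mem fun j hj => Submodule.mem_iSup_of_mem j <|
    Submodule.mem_iSup_of_mem (Finset.min'_lt_of_mem_erase_min' _ _ hj) (hc j)

end LinearAlgebra

namespace VertexAlgebra

open Module.End

variable {V : Type*} [AddCommGroup V] [Module ℂ V] (U : VertexAlgebra V)

section Modes

/-- The mode `u(n)` as a linear function of the state `u`. -/
noncomputable def modeHom (n : ℤ) : V →ₗ[ℂ] Module.End ℂ V :=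
  LinearMap.proj n ∘ₗ VertexOperator.ncoeff ∘ₗ U.Y

lemma modeHom_apply (u : V) (n : ℤ) : U.modeHom n u = U.mode u n :=
  rfl

lemma mode_add (u v : V) (n : ℤ) : U.mode (u + v) n = U.mode u n + U.mode v n :=
  map_add (U.modeHom n) u v

lemma mode_smul (c : ℂ) (u : V) (n : ℤ) : U.mode (c • u) n = c • U.mode u n :=
  map_smul (U.modeHom n) c u

@[simp] lemma mode_zero (n : ℤ) : U.mode 0 n = 0 :=
  map_zero (U.modeHom n)

lemma mode_vac (n : ℤ) (v : V) : U.mode U.vac n v = if n = -1 then v else 0 :=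
  U.vacuum n v

lemma mode_neg_one_vac (v : V) : U.mode v (-1) U.vac = v :=
  U.creation v

lemma mode_apply_vac_of_nonneg (v : V) {n : ℤ} (hn : 0 ≤ n) : U.mode v n U.vac = 0 :=
  U.creation_nonneg v n hn

lemma vac_ne_zero [Nontrivial V] : U.vac ≠ 0 := by
  obtain ⟨v, hv⟩ := exists_ne (0 : V)
  intro h
  simpa [h, hv.symm] using U.mode_vac (-1) v

lemma mode_commutator (u v w : V) (m n : ℤ) :
    U.mode u m (U.mode v n w) - U.mode v n (U.mode u m w) =
      ∑ᶠ i : ℕ, Ring.choose m i • U.mode (U.mode u i v) (m + n - i) w := by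
  have hchoose : ∀ i : ℕ, i ≠ 0 → Ring.choose (0 : ℤ) i = 0 := fun i hi =>
    Ring.choose_zero_pos ℤ (Nat.pos_of_ne_zero hi)
  have h := U.jacobi u v w 0 m n
  simp only [← mode.eq_1, zero_add] at h
  rw [h, finsum_eq_single _ 0 fun i hi => by simp [hchoose i hi],
    finsum_eq_single _ 0 fun i hi => by simp [hchoose i hi]]
  simp

lemma mode_commutator_natCast (u v w : V) (m : ℕ) (n : ℤ) :
    U.mode u m (U.mode v n w) - U.mode v n (U.mode u m w) =
      ∑ i ∈ Finset.range (m + 1), m.choose i • U.mode (U.mode u i v) (m + n - i) w := by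
  rw [mode_commutator, finsum_eq_sum_of_support_subset (s := Finset.range (m + 1))]
  · simp [Ring.choose_natCast]
  · intro i hi
    contrapose! hi
    have : m < i := by simpa using hi
    simp [Ring.choose_natCast, Nat.choose_eq_zero_of_lt this]

lemma mode_zero_apply_mode (u v w : V) (n : ℤ) :
    U.mode u 0 (U.mode v n w) = U.mode v n (U.mode u 0 w) + U.mode (U.mode u 0 v) n w := by
  rw [← sub_eq_iff_eq_add']
  simpa using U.mode_commutator_natCast u v w 0 n

lemma mode_one_apply_mode (u v w : V) (n : ℤ) :
    U.mode u 1 (U.mode v n w) = U.mode v n (U.mode u 1 w) +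
      (U.mode (U.mode u 0 v) (n + 1) w + U.mode (U.mode u 1 v) n w) := by
  rw [← sub_eq_iff_eq_add']
  simpa [Finset.sum_range_succ, add_comm] using U.mode_commutator_natCast u v w 1 n

end Modes

variable {U}

lemma mem_weightSpace {ω v : V} {n : ℤ} :
    v ∈ U.weightSpace ω n ↔ U.vir ω 0 v = (n : ℂ) • v :=
  mem_eigenspace_iff

lemma mem_weightSpace_zero {ω v : V} : v ∈ U.weightSpace ω 0 ↔ U.vir ω 0 v = 0 := by
  simp [mem_weightSpace]

lemma vir_vac (ω : V) {n : ℤ} (hn : -1 ≤ n) : U.vir ω n U.vac = 0 :=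
  U.mode_apply_vac_of_nonneg ω (by omega)

lemma vir_neg_two_vac (ω : V) : U.vir ω (-2) U.vac = ω :=
  U.mode_neg_one_vac ω

lemma vac_mem_weightSpace (ω : V) : U.vac ∈ U.weightSpace ω 0 :=
  mem_weightSpace_zero.2 (vir_vac ω (by norm_num))

namespace IsVOA

variable {ω : V} (hV : U.IsVOA ω)

include hV

lemma iSup_weightSpace : ⨆ n, U.weightSpace ω n = ⊤ :=
  hV.grading.submodule_iSup_eq_top

lemma iSup_eigenspace_vir_zero : ⨆ p, (U.vir ω 0).eigenspace p = ⊤ :=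
  top_unique <| hV.iSup_weightSpace.symm.le.trans <|
    iSup_le fun n => le_iSup (U.vir ω 0).eigenspace (n : ℂ)

lemma hom_ext {M : Type*} [AddCommGroup M] [Module ℂ M] {f g : V →ₗ[ℂ] M}
    (hfg : ∀ n, ∀ v ∈ U.weightSpace ω n, f v = g v) : f = g := by
  rw [← LinearMap.eqLocus_eq_top, ← top_le_iff, ← hV.iSup_weightSpace]
  exact iSup_le hfg

lemma exists_int_of_eigenspace_ne_bot {p : ℂ} (hp : (U.vir ω 0).eigenspace p ≠ ⊥) :
    ∃ n : ℤ, p = n := by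
  by_contra! hn
  have hdisj := (U.vir ω 0).eigenspaces_iSupIndep p
  have htop : ⨆ q ≠ p, (U.vir ω 0).eigenspace q = ⊤ := by
    rw [← top_le_iff, ← hV.iSup_weightSpace]
    exact iSup_le fun n => le_iSup₂_of_le (n : ℂ) (hn n).symm le_rfl
  rw [htop, disjoint_top] at hdisj
  exact hp hdisj

section Virasoro

attribute [local instance] LieRing.ofAssociativeRing

/-- The central term of `⁅L(m), L(n)⁆` vanishes when `m` is `-1`, `0` or `1`. -/
lemma lie_vir {m : ℤ} (hm : m ^ 3 = m) (n : ℤ) :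
    ⁅U.vir ω m, U.vir ω n⁆ = ((m : ℂ) - n) • U.vir ω (m + n) := by
  obtain ⟨c, hc⟩ := hV.virasoro
  have hm' : (m : ℂ) ^ 3 - m = 0 := by exact_mod_cast sub_eq_zero.2 hm
  simp [Ring.lie_def, hc, hm']

lemma vir_apply_vir {m : ℤ} (hm : m ^ 3 = m) (n : ℤ) (v : V) :
    U.vir ω m (U.vir ω n v) = U.vir ω n (U.vir ω m v) + ((m : ℂ) - n) • U.vir ω (m + n) v := by
  rw [← sub_eq_iff_eq_add']
  exact LinearMap.congr_fun (hV.lie_vir hm n) v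

lemma vir_mem_weightSpace {k : ℤ} {v : V} (hv : v ∈ U.weightSpace ω k) (m : ℤ) :
    U.vir ω m v ∈ U.weightSpace ω (k - m) := by
  rw [mem_weightSpace] at hv ⊢
  rw [hV.vir_apply_vir (by norm_num), hv, map_smul, zero_add, ← add_smul]
  push_cast
  ring_nf

lemma pow_vir_mem_weightSpace {k : ℤ} {v : V} (hv : v ∈ U.weightSpace ω k) (m : ℤ) (i : ℕ) :
    (U.vir ω m ^ i) v ∈ U.weightSpace ω (k - i * m) := by
  induction i with
  | zero => simpa using hv
  | succ i ih =>
    rw [pow_succ', Module.End.mul_apply]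
    convert hV.vir_mem_weightSpace ih m using 2
    push_cast
    ring

lemma conformal_mem_weightSpace : ω ∈ U.weightSpace ω 2 := by
  simpa [vir_neg_two_vac] using hV.vir_mem_weightSpace (vac_mem_weightSpace ω) (-2)

lemma vir_one_conformal : U.vir ω 1 ω = 0 := by
  have h := hV.vir_apply_vir (by norm_num : (1 : ℤ) ^ 3 = 1) (-2) U.vac
  rw [vir_neg_two_vac] at h
  simpa [vir_vac] using h

lemma isSl2Triple (h0 : U.vir ω 0 ≠ 0) :
    IsSl2Triple ((-2 : ℂ) • U.vir ω 0) (-U.vir ω 1) (U.vir ω (-1)) where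
  h_ne_zero := smul_ne_zero (by norm_num) h0
  lie_e_f := by
    rw [neg_lie, hV.lie_vir (by norm_num)]
    norm_num
  lie_h_e_nsmul := by
    rw [smul_lie, lie_neg, hV.lie_vir (by norm_num), zero_add]
    push_cast
    module
  lie_h_f_nsmul := by
    rw [smul_lie, hV.lie_vir (by norm_num), zero_add]
    push_cast
    module

lemma pow_vir_neg_one_ne_zero {n : ℤ} (hn : n < 0) {v : V} (hv : v ∈ U.weightSpace ω n)
    (hv0 : v ≠ 0) (h1 : U.vir ω 1 v = 0) {i : ℕ} (hi : i ≤ -2 * n) :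
    (U.vir ω (-1) ^ i) v ≠ 0 := by
  rw [mem_weightSpace] at hv
  have hL0 : U.vir ω 0 ≠ 0 := by
    intro h
    rw [h, LinearMap.zero_apply, eq_comm, smul_eq_zero, Int.cast_eq_zero] at hv
    exact hv.elim hn.ne hv0
  have hprim : (hV.isSl2Triple hL0).HasPrimitiveVectorWith v (-2 * n : ℂ) :=
    { ne_zero := hv0
      lie_h := by simp [hv, smul_smul]
      lie_e := by simp [h1] }
  obtain ⟨d, hd⟩ := Int.eq_ofNat_of_zero_le (show 0 ≤ -2 * n by omega)
  exact hprim.pow_toEnd_f_ne_zero_of_eq_nat (n := d) (by exact_mod_cast hd) (by omega)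

lemma exists_vir_one_eq_zero_of_not_isNGraded (hN : ¬U.IsNGraded ω) :
    ∃ n < 0, ∃ v ∈ U.weightSpace ω n, v ≠ 0 ∧ U.vir ω 1 v = 0 := by
  obtain ⟨N, hbelow⟩ := hV.bounded
  obtain ⟨n, ⟨hn, hne⟩, hmin⟩ := Int.exists_least_of_bdd
    (P := fun n => n < 0 ∧ U.weightSpace ω n ≠ ⊥)
    ⟨N, fun m hm => not_lt.1 fun hlt => hm.2 (hbelow m hlt)⟩ (by simpa [IsNGraded] using hN)
  obtain ⟨v, hv, hv0⟩ := Submodule.exists_mem_ne_zero_of_ne_bot hne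
  have hbot : U.weightSpace ω (n - 1) = ⊥ := by
    by_contra h
    have := hmin _ ⟨by omega, h⟩
    omega
  exact ⟨n, hn, v, hv, hv0, by simpa [hbot] using hV.vir_mem_weightSpace hv 1⟩

/-- A lowest weight vector of weight `n < 0` would have a nonzero descendant `L(-1)^(1-n) v`,
although `L(-1)^(-n) v` is a multiple of the vacuum, which `L(-1)` annihilates. -/
lemma isNGraded_of_isCFTType (h0 : U.IsCFTType ω) : U.IsNGraded ω := by
  by_contra hN
  obtain ⟨n, hn, v, hv, hv0, h1⟩ := hV.exists_vir_one_eq_zero_of_not_isNGraded hN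
  obtain ⟨d, rfl⟩ : ∃ d : ℕ, n = -d := ⟨n.natAbs, by omega⟩
  have hvac : (U.vir ω (-1) ^ d) v ∈ Submodule.span ℂ {U.vac} := by
    rw [← h0]
    simpa using hV.pow_vir_mem_weightSpace hv (-1) d
  obtain ⟨c, hc⟩ := Submodule.mem_span_singleton.1 hvac
  refine hV.pow_vir_neg_one_ne_zero hn hv hv0 h1 (i := d + 1) (by omega) ?_
  rw [pow_succ', Module.End.mul_apply, ← hc, map_smul, vir_vac ω le_rfl, smul_zero]

end Virasoro

section Grading

lemma vir_zero_apply_mode (u v : V) (n : ℤ) :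
    U.vir ω 0 (U.mode u n v) = U.mode u n (U.vir ω 0 v) + U.mode (U.vir ω 0 u) n v
      - ((n : ℂ) + 1) • U.mode u n v := by
  have hcomm : U.vir ω 0 (U.mode u n v) = U.mode u n (U.vir ω 0 v) +
      (U.mode (U.vir ω (-1) u) (n + 1) v + U.mode (U.vir ω 0 u) n v) := by
    simpa [vir] using U.mode_one_apply_mode ω u v n
  rw [hcomm, hV.derivative, add_sub_cancel_right, LinearMap.smul_apply]
  push_cast
  module

lemma mode_mem_weightSpace {a b : ℤ} {u v : V} (hu : u ∈ U.weightSpace ω a)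
    (hv : v ∈ U.weightSpace ω b) (n : ℤ) : U.mode u n v ∈ U.weightSpace ω (a + b - n - 1) := by
  rw [mem_weightSpace] at *
  rw [hV.vir_zero_apply_mode, hu, hv, map_smul, mode_smul, LinearMap.smul_apply]
  push_cast
  module

lemma mode_one_mem_span_vac (h0 : U.IsCFTType ω) {u v : V} (hu : u ∈ U.weightSpace ω 1)
    (hv : v ∈ U.weightSpace ω 1) : U.mode u 1 v ∈ Submodule.span ℂ {U.vac} := by
  rw [← h0]
  simpa using hV.mode_mem_weightSpace hu hv 1

lemma mode_zero_skew (h0 : U.IsCFTType ω) {u v : V} (hu : u ∈ U.weightSpace ω 1)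
    (hv : v ∈ U.weightSpace ω 1) : U.mode v 0 u = -U.mode u 0 v := by
  have hcomm := U.mode_commutator u v U.vac (-1) 0
  rw [finsum_eq_single _ 0 fun i hi => ?_] at hcomm
  · simpa [mode_neg_one_vac, mode_apply_vac_of_nonneg, neg_eq_iff_eq_neg] using hcomm
  obtain rfl | hi1 := eq_or_ne i 1
  · obtain ⟨c, hc⟩ := Submodule.mem_span_singleton.1 (hV.mode_one_mem_span_vac h0 hu hv)
    simp [← hc, mode_smul, mode_vac]
  · have hmem := hV.mode_mem_weightSpace hu hv i
    rw [hV.isNGraded_of_isCFTType h0 _ (by omega), Submodule.mem_bot] at hmem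
    simp [hmem]

lemma mode_zero_self (h0 : U.IsCFTType ω) {u : V} (hu : u ∈ U.weightSpace ω 1) :
    U.mode u 0 u = 0 :=
  have : IsAddTorsionFree V := .of_isTorsionFree ℂ V
  self_eq_neg.1 (hV.mode_zero_skew h0 hu hu)

variable (hN : U.IsNGraded ω)

include hN

lemma mode_neg_one_comm {a b : V} (ha : a ∈ U.weightSpace ω 0) (hb : b ∈ U.weightSpace ω 0) :
    U.mode a (-1) b = U.mode b (-1) a := by
  have hzero : ∀ i : ℕ, U.mode a i b = 0 := fun i => by
    have hmem := hV.mode_mem_weightSpace ha hb i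
    rwa [hN _ (by omega), Submodule.mem_bot] at hmem
  have hcomm := U.mode_commutator a b U.vac (-1) (-1)
  simpa [hzero, mode_neg_one_vac, sub_eq_zero] using hcomm

lemma vir_one_eq_zero_of_mem_weightSpace_zero {a : V} (ha : a ∈ U.weightSpace ω 0) :
    U.vir ω 1 a = 0 := by
  have hmem := hV.vir_mem_weightSpace ha 1
  rwa [hN _ (by omega), Submodule.mem_bot] at hmem

end Grading

end IsVOA

namespace IsInvariant

variable {ω : V} {B : LinearMap.BilinForm ℂ V} (hB : U.IsInvariant ω B)

include hB

lemma apply_mode_of_vir_one_eq_smul_vac {k : ℤ} {u : V} (hu : u ∈ U.weightSpace ω k) {c : ℂ}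
    (h1 : U.vir ω 1 u = c • U.vac) (n : ℤ) (v w : V) :
    B (U.mode u n v) w = (-1) ^ k *
      (B v (U.mode u (2 * k - n - 2) w) + c * B v (U.mode U.vac (2 * k - n - 3) w)) := by
  rw [hB k u hu, finsum_eq_sum_of_support_subset (s := Finset.range 2)]
  · rw [Finset.sum_range_succ, Finset.sum_range_one, pow_one, h1, mode_smul]
    simp only [Nat.factorial_zero, Nat.factorial_one, Nat.cast_zero, Nat.cast_one, div_one,
      pow_zero, Module.End.one_apply, sub_zero, LinearMap.smul_apply, map_smul, smul_eq_mul]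
    ring_nf
  · intro i hi
    contrapose! hi
    have hi2 : 2 ≤ i := by simpa [Nat.lt_iff_add_one_le] using hi
    obtain ⟨j, rfl⟩ := Nat.exists_eq_add_of_le' hi2
    simp [pow_succ, h1, vir_vac]

lemma apply_mode_of_vir_one_eq_zero {k : ℤ} {u : V} (hu : u ∈ U.weightSpace ω k)
    (h1 : U.vir ω 1 u = 0) (n : ℤ) (v w : V) :
    B (U.mode u n v) w = (-1) ^ k * B v (U.mode u (2 * k - n - 2) w) := by
  simpa using hB.apply_mode_of_vir_one_eq_smul_vac hu (c := 0) (by simpa using h1) n v w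

section IsVOA

variable (hV : U.IsVOA ω)

include hV

lemma apply_vir (n : ℤ) (v w : V) : B (U.vir ω n v) w = B v (U.vir ω (-n) w) := by
  rw [vir, hB.apply_mode_of_vir_one_eq_zero hV.conformal_mem_weightSpace hV.vir_one_conformal, vir,
    show 2 * 2 - (n + 1) - 2 = -n + 1 by ring]
  norm_num

lemma apply_eq_zero_of_ne {m n : ℤ} (hmn : m ≠ n) {v w : V} (hv : v ∈ U.weightSpace ω m)
    (hw : w ∈ U.weightSpace ω n) : B v w = 0 := by
  have hadj := hB.apply_vir hV 0 v w
  rw [neg_zero, mem_weightSpace.1 hv, mem_weightSpace.1 hw, map_smul, LinearMap.smul_apply,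
    map_smul, smul_eq_mul, smul_eq_mul] at hadj
  by_contra hne
  exact hmn (by exact_mod_cast mul_right_cancel₀ hne hadj)

section Nondegenerate

variable (hs : U.IsSimple) (hB0 : B ≠ 0)

include hs hB0

lemma ker_eq_bot : LinearMap.ker B = ⊥ := by
  refine (hs.2 _ fun u n x hx => ?_).resolve_right fun htop => hB0 (LinearMap.ker_eq_top.1 htop)
  suffices B ∘ₗ (U.modeHom n).flip x = 0 from LinearMap.congr_fun this u
  refine hV.hom_ext fun k u hu => LinearMap.ext fun w => ?_
  rw [LinearMap.mem_ker] at hx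
  simp [modeHom_apply, hB k u hu, hx]

lemma exists_apply_ne_zero {n : ℤ} {a : V} (ha : a ∈ U.weightSpace ω n) (ha0 : a ≠ 0) :
    ∃ b ∈ U.weightSpace ω n, B a b ≠ 0 := by
  by_contra! hz
  refine ha0 ((LinearMap.ker_eq_bot'.1 (hB.ker_eq_bot hV hs hB0)) a (hV.hom_ext fun m w hw => ?_))
  obtain rfl | hnm := eq_or_ne n m
  · exact hz w hw
  · exact hB.apply_eq_zero_of_ne hV hnm ha hw

/-- `L(1)u` is orthogonal to the vacuum, hence to all of `V_0`, because `L(-1)` annihilates the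
vacuum. -/
lemma vir_one_eq_zero_of_isCFTType (h0 : U.IsCFTType ω) {u : V} (hu : u ∈ U.weightSpace ω 1) :
    U.vir ω 1 u = 0 := by
  by_contra hne
  obtain ⟨b, hb, hub⟩ := hB.exists_apply_ne_zero hV hs hB0 (hV.vir_mem_weightSpace hu 1) hne
  rw [sub_self, h0] at hb
  obtain ⟨c, rfl⟩ := Submodule.mem_span_singleton.1 hb
  exact hub (by simp [hB.apply_vir hV, vir_vac])

end Nondegenerate

section IsNGraded

variable (hN : U.IsNGraded ω) {a b : V} (ha : a ∈ U.weightSpace ω 0)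

include hN ha

lemma apply_mode_neg_one (v w : V) : B (U.mode a (-1) v) w = B v (U.mode a (-1) w) := by
  simpa using hB.apply_mode_of_vir_one_eq_zero ha
    (hV.vir_one_eq_zero_of_mem_weightSpace_zero hN ha) (-1) v w

lemma apply_eq_apply_vac (v : V) : B a v = B U.vac (U.mode a (-1) v) := by
  rw [← hB.apply_mode_neg_one hV hN ha, mode_neg_one_vac]

lemma apply_comm (hb : b ∈ U.weightSpace ω 0) : B a b = B b a := by
  rw [hB.apply_eq_apply_vac hV hN ha, hV.mode_neg_one_comm hN ha hb,
    ← hB.apply_eq_apply_vac hV hN hb]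

end IsNGraded

end IsVOA

end IsInvariant

section Shift

variable {ω' h : V}

lemma iSupIndep_deRham : iSupIndep (U.deRham ω' h) :=
  (U.mode h 0).eigenspaces_iSupIndep.mono fun _ => inf_le_right

namespace IsVOA

lemma mode_mem_deRham (hV : U.IsVOA (U.shift ω' h)) {p q : ℂ} {a b : V}
    (ha : a ∈ U.deRham ω' h p) (hb : b ∈ U.deRham ω' h q) :
    U.mode a (-1) b ∈ U.deRham ω' h (p + q) := by
  refine ⟨by simpa using hV.mode_mem_weightSpace ha.1 hb.1 (-1), mem_eigenspace_iff.2 ?_⟩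
  rw [mode_zero_apply_mode, mem_eigenspace_iff.1 ha.2, mem_eigenspace_iff.1 hb.2, mode_smul,
    map_smul, LinearMap.smul_apply, add_smul, add_comm]

lemma finiteDimensional_deRham (hV : U.IsVOA (U.shift ω' h)) (p : ℂ) :
    FiniteDimensional ℂ (U.deRham ω' h p) :=
  have := hV.finite 0
  Submodule.finiteDimensional_of_le (S₂ := U.weightSpace (U.shift ω' h) 0) inf_le_left

variable (hW : U.IsVOA ω')

include hW

lemma vir_shift (n : ℤ) :
    U.vir (U.shift ω' h) n = U.vir ω' n - ((n : ℂ) + 1) • U.mode h n := by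
  rw [vir, shift, mode_add, hW.derivative, add_sub_cancel_right, vir]
  push_cast
  module

lemma vir_shift_zero : U.vir (U.shift ω' h) 0 = U.vir ω' 0 - U.mode h 0 := by
  simp [hW.vir_shift]

lemma mem_weightSpace_shift_zero {v : V} :
    v ∈ U.weightSpace (U.shift ω' h) 0 ↔ U.vir ω' 0 v = U.mode h 0 v := by
  rw [mem_weightSpace_zero, hW.vir_shift_zero, LinearMap.sub_apply, sub_eq_zero]

lemma deRham_eq_inf_eigenspace_vir_zero (p : ℂ) :
    U.deRham ω' h p = U.weightSpace (U.shift ω' h) 0 ⊓ (U.vir ω' 0).eigenspace p := by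
  ext v
  refine and_congr_right fun hv => ?_
  rw [SetLike.mem_coe, SetLike.mem_coe, mem_eigenspace_iff, mem_eigenspace_iff,
    hW.mem_weightSpace_shift_zero.1 hv]

lemma deRham_eq_jointEigenspace (p : ℂ) : U.deRham ω' h p = U.jointEigenspace ω' h p p := by
  ext v
  rw [deRham, jointEigenspace, Submodule.mem_inf, Submodule.mem_inf, mem_eigenspace_iff,
    mem_eigenspace_iff, hW.mem_weightSpace_shift_zero]
  exact and_congr_left fun hv => by rw [hv]

end IsVOA

end Shift

namespace IsShiftedTriple

variable {ω' h : V} (hT : U.IsShiftedTriple ω' h)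

include hT

lemma exists_mode_one_self : ∃ ν : ℂ, U.mode h 1 h = (ν / 2) • U.vac := by
  obtain ⟨c, hc⟩ := Submodule.mem_span_singleton.1
    (hT.isVOA_W.mode_one_mem_span_vac hT.cftType_W hT.mem_W_one hT.mem_W_one)
  exact ⟨2 * c, by rw [← hc, mul_div_cancel_left₀ c two_ne_zero]⟩

lemma mem_weightSpace_shift_one : h ∈ U.weightSpace (U.shift ω' h) 1 := by
  rw [mem_weightSpace, hT.isVOA_W.vir_shift_zero, LinearMap.sub_apply,
    hT.isVOA_W.mode_zero_self hT.cftType_W hT.mem_W_one, sub_zero, mem_weightSpace.1 hT.mem_W_one]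

lemma vir_shift_one_self {ν : ℂ} (hν : U.mode h 1 h = (ν / 2) • U.vac) :
    U.vir (U.shift ω' h) 1 h = -ν • U.vac := by
  obtain ⟨B, hB0, hB⟩ := hT.selfDual_W
  have hL1 : U.vir ω' 1 h = 0 :=
    hB.vir_one_eq_zero_of_isCFTType hT.isVOA_W hT.simple_V hB0 hT.cftType_W hT.mem_W_one
  rw [hT.isVOA_W.vir_shift, LinearMap.sub_apply, LinearMap.smul_apply, hL1, hν]
  push_cast
  module

lemma mode_zero_mem {v : V} (hv : v ∈ U.weightSpace (U.shift ω' h) 0) :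
    U.mode h 0 v ∈ U.weightSpace (U.shift ω' h) 0 := by
  simpa using hT.isVOA_V.mode_mem_weightSpace hT.mem_weightSpace_shift_one hv 0

lemma iSup_deRham : ⨆ p, U.deRham ω' h p = U.weightSpace (U.shift ω' h) 0 := by
  simp_rw [hT.isVOA_W.deRham_eq_inf_eigenspace_vir_zero]
  refine iSup_inf_eigenspace_eq_of_mapsTo hT.isVOA_W.iSup_eigenspace_vir_zero fun v hv => ?_
  rw [hT.isVOA_W.mem_weightSpace_shift_zero.1 hv]
  exact hT.mode_zero_mem hv

lemma exists_nat_of_deRham_ne_bot {p : ℂ} (hp : U.deRham ω' h p ≠ ⊥) : ∃ n : ℕ, p = n := by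
  have hp' : (U.vir ω' 0).eigenspace p ≠ ⊥ := by
    rw [hT.isVOA_W.deRham_eq_inf_eigenspace_vir_zero] at hp
    exact ne_bot_of_le_ne_bot hp inf_le_right
  obtain ⟨n, rfl⟩ := hT.isVOA_W.exists_int_of_eigenspace_ne_bot hp'
  have hn : 0 ≤ n := not_lt.1 fun hn =>
    hp' (hT.isVOA_W.isNGraded_of_isCFTType hT.cftType_W n hn)
  exact ⟨n.toNat, by exact_mod_cast (Int.toNat_of_nonneg hn).symm⟩

lemma iSup_deRham_natCast : ⨆ n : ℕ, U.deRham ω' h n = U.weightSpace (U.shift ω' h) 0 := by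
  refine le_antisymm (iSup_le fun _ => inf_le_left) (hT.iSup_deRham ▸ iSup_le fun p => ?_)
  by_cases hp : U.deRham ω' h p = ⊥
  · simp [hp]
  · obtain ⟨n, rfl⟩ := hT.exists_nat_of_deRham_ne_bot hp
    exact le_iSup (fun n : ℕ => U.deRham ω' h n) n

lemma deRham_zero : U.deRham ω' h 0 = Submodule.span ℂ {U.vac} := by
  refine le_antisymm ?_ ((Submodule.span_singleton_le_iff_mem _ _).2
    ⟨vac_mem_weightSpace _, by simp [U.mode_apply_vac_of_nonneg h le_rfl]⟩)
  rw [hT.isVOA_W.deRham_eq_inf_eigenspace_vir_zero, ← hT.cftType_W, weightSpace, weightSpace,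
    Int.cast_zero]
  exact inf_le_right

section Duality

variable {ν : ℂ} (hν : U.mode h 1 h = (ν / 2) • U.vac)

include hν

section Form

variable {B : LinearMap.BilinForm ℂ V} (hB : U.IsInvariant (U.shift ω' h) B)

include hB

lemma apply_mode_zero (v w : V) : B (U.mode h 0 v) w = ν * B v w - B v (U.mode h 0 w) := by
  rw [hB.apply_mode_of_vir_one_eq_smul_vac hT.mem_weightSpace_shift_one
    (hT.vir_shift_one_self hν), zpow_one, mode_vac, if_pos (by norm_num),
    show (2 * 1 - 0 - 2 : ℤ) = 0 by norm_num]
  ring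

lemma apply_eq_zero_of_add_ne {p q : ℂ} (hpq : p + q ≠ ν) {a b : V} (ha : a ∈ U.deRham ω' h p)
    (hb : b ∈ U.deRham ω' h q) : B a b = 0 := by
  have hadj := hT.apply_mode_zero hν hB a b
  rw [mem_eigenspace_iff.1 ha.2, mem_eigenspace_iff.1 hb.2, map_smul, map_smul,
    LinearMap.smul_apply, smul_eq_mul, smul_eq_mul] at hadj
  by_contra hne
  exact hpq (mul_right_cancel₀ hne (by linear_combination hadj))

variable (hB0 : B ≠ 0)

include hB0

lemma exists_apply_ne_zero {p : ℂ} {a : V} (ha : a ∈ U.deRham ω' h p) (ha0 : a ≠ 0) :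
    ∃ b ∈ U.deRham ω' h (ν - p), B a b ≠ 0 := by
  by_contra! hz
  have hker : U.weightSpace (U.shift ω' h) 0 ≤ LinearMap.ker (B a) := by
    refine hT.iSup_deRham ▸ iSup_le fun q b hb => ?_
    by_cases hpq : p + q = ν
    · exact hz b (by rwa [← hpq, add_sub_cancel_left])
    · exact hT.apply_eq_zero_of_add_ne hν hB hpq ha hb
  obtain ⟨b, hb, hab⟩ := hB.exists_apply_ne_zero hT.isVOA_V hT.simple_V hB0 ha.1 ha0
  exact hab (hker hb)

lemma isPerfPair_deRham {p q : ℂ} (hpq : p + q = ν) :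
    (B.domRestrict₁₂ (U.deRham ω' h p) (U.deRham ω' h q)).IsPerfPair := by
  have := hT.isVOA_V.finiteDimensional_deRham p
  refine .of_injective ?_ ?_ <;> rw [← LinearMap.ker_eq_bot, LinearMap.ker_eq_bot']
  · rintro ⟨a, ha⟩ hker
    by_contra ha0
    obtain ⟨b, hb, hab⟩ := hT.exists_apply_ne_zero hν hB hB0 ha (by simpa using ha0)
    exact hab (LinearMap.congr_fun hker ⟨b, by rwa [← sub_eq_of_eq_add' hpq.symm]⟩)
  · rintro ⟨b, hb⟩ hker
    by_contra hb0
    obtain ⟨a, ha, hba⟩ := hT.exists_apply_ne_zero hν hB hB0 hb (by simpa using hb0)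
    rw [hB.apply_comm hT.isVOA_V hT.nGraded_V hb.1 ha.1] at hba
    exact hba (LinearMap.congr_fun hker ⟨a, by rwa [← sub_eq_of_eq_add hpq.symm]⟩)

end Form

lemma isAtom_deRham : IsAtom (U.deRham ω' h ν) := by
  have := hT.simple_V.1
  have := hT.isVOA_V.finiteDimensional_deRham
  obtain ⟨B, hB0, hB⟩ := hT.selfDual_V
  have := hT.isPerfPair_deRham hν hB hB0 (zero_add ν)
  rw [Submodule.isAtom_iff_finrank_eq_one, ← Module.finrank_of_isPerfPair
    (B.domRestrict₁₂ (U.deRham ω' h 0) (U.deRham ω' h ν)), hT.deRham_zero]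
  exact finrank_span_singleton U.vac_ne_zero

lemma deRham_add_eq_bot {k : ℕ} (hk : k ≠ 0) : U.deRham ω' h (k + ν) = ⊥ := by
  by_contra hne
  obtain ⟨B, hB0, hB⟩ := hT.selfDual_V
  obtain ⟨a, ha, ha0⟩ := Submodule.exists_mem_ne_zero_of_ne_bot hne
  obtain ⟨b, hb, hab⟩ := hT.exists_apply_ne_zero hν hB hB0 ha ha0
  obtain ⟨m, hm⟩ := hT.exists_nat_of_deRham_ne_bot
    ((Submodule.ne_bot_iff _).2 ⟨b, hb, by rintro rfl; simp at hab⟩)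
  have hkm : k + m = 0 := by
    rw [← Nat.cast_eq_zero (R := ℂ)]
    push_cast
    linear_combination -hm
  omega

lemma isZeroIdeal_deRham : U.IsZeroIdeal (U.shift ω' h) (U.deRham ω' h ν) := by
  refine ⟨inf_le_left, fun a ha x hx => ?_⟩
  rw [hT.isVOA_V.mode_neg_one_comm hT.nGraded_V hx.1 ha, and_self]
  suffices U.weightSpace (U.shift ω' h) 0 ≤
    (U.deRham ω' h ν).comap ((U.modeHom (-1)).flip x) from this ha
  refine hT.iSup_deRham_natCast ▸ iSup_le fun n b hb => ?_
  have hbx := hT.isVOA_V.mode_mem_deRham hb hx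
  obtain rfl | hn := eq_or_ne n 0
  · rwa [Nat.cast_zero, zero_add] at hbx
  · rw [hT.deRham_add_eq_bot hν hn] at hbx
    exact (bot_le : ⊥ ≤ U.deRham ω' h ν) hbx

/-- Multiply `x` by a state dual to its component of lowest degree: the products with the other
components have degree greater than `ν`, hence vanish. -/
lemma exists_mode_mem_deRham_ne_zero {x : V} (hx : x ∈ U.weightSpace (U.shift ω' h) 0)
    (hx0 : x ≠ 0) : ∃ y ∈ U.weightSpace (U.shift ω' h) 0,
      U.mode x (-1) y ∈ U.deRham ω' h ν ∧ U.mode x (-1) y ≠ 0 := by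
  obtain ⟨B, hB0, hB⟩ := hT.selfDual_V
  rw [← hT.iSup_deRham_natCast] at hx
  obtain ⟨n, c, hc, hc0, hxc⟩ := exists_sub_mem_iSup_gt _ hx hx0
  obtain ⟨y, hy, hcy⟩ := hT.exists_apply_ne_zero hν hB hB0 hc hc0
  have hker : ⨆ m > n, U.deRham ω' h (m : ℂ) ≤ LinearMap.ker ((U.modeHom (-1)).flip y) := by
    refine iSup₂_le fun m hm b hb => ?_
    have hby := hT.isVOA_V.mode_mem_deRham hb hy
    rw [show (m : ℂ) + (ν - n) = (m - n : ℕ) + ν by rw [Nat.cast_sub hm.le]; ring,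
      hT.deRham_add_eq_bot hν (Nat.sub_ne_zero_of_lt hm)] at hby
    exact hby
  have hxy : U.mode x (-1) y = U.mode c (-1) y := LinearMap.sub_mem_ker_iff.1 (hker hxc)
  rw [hB.apply_eq_apply_vac hT.isVOA_V hT.nGraded_V hc.1, ← hxy] at hcy
  refine ⟨y, hy.1, ?_, fun hzero => hcy (by rw [hzero, map_zero])⟩
  rw [hxy]
  simpa using hT.isVOA_V.mode_mem_deRham hc hy

lemma deRham_le_of_isZeroIdeal {I : Submodule ℂ V} (hI : U.IsZeroIdeal (U.shift ω' h) I)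
    (hI0 : I ≠ ⊥) : U.deRham ω' h ν ≤ I := by
  obtain ⟨x, hx, hx0⟩ := Submodule.exists_mem_ne_zero_of_ne_bot hI0
  obtain ⟨y, hy, hmem, hne⟩ := hT.exists_mode_mem_deRham_ne_zero hν (hI.1 hx) hx0
  refine (hT.isAtom_deRham hν).not_disjoint_iff_le.1 fun hdisj => hne ?_
  exact Submodule.disjoint_def.1 hdisj _ hmem (hI.2 y hy x hx).2

lemma isLeast_deRham :
    IsLeast {I : Submodule ℂ V | U.IsZeroIdeal (U.shift ω' h) I ∧ I ≠ ⊥} (U.deRham ω' h ν) :=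
  ⟨⟨hT.isZeroIdeal_deRham hν, (hT.isAtom_deRham hν).1⟩,
    fun _ hI => hT.deRham_le_of_isZeroIdeal hν hI.1 hI.2⟩

lemma exists_deRham_eq_span_singleton : ∃ t : V, t ≠ 0 ∧ U.deRham ω' h ν = Submodule.span ℂ {t} :=
  (atom_iff_nonzero_span _).1 (hT.isAtom_deRham hν)

end Duality

end IsShiftedTriple

end VertexAlgebra

theorem theorem5p1 {V : Type*} [AddCommGroup V] [Module ℂ V]
    (U : VertexAlgebra V) (ω' h : V) (hT : U.IsShiftedTriple ω' h) :
    -- `A^p` is the `p`-eigenspace of `h(0)` on `V_0`, and it equals `W_{p,p}`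
    (∀ v ∈ U.weightSpace (U.shift ω' h) 0, U.mode h 0 v ∈ U.weightSpace (U.shift ω' h) 0) ∧
    (∀ p : ℂ, U.deRham ω' h p = U.jointEigenspace ω' h p p) ∧
    -- (i)
    iSupIndep (U.deRham ω' h) ∧
    (⨆ p : ℂ, U.deRham ω' h p) = U.weightSpace (U.shift ω' h) 0 ∧
    (∀ p : ℂ, U.deRham ω' h p ≠ ⊥ → ∃ n : ℕ, p = n) ∧
    -- (ii)
    U.deRham ω' h 0 = Submodule.span ℂ {U.vac} ∧
    -- (iv)
    (∀ p q : ℂ, ∀ a ∈ U.deRham ω' h p, ∀ b ∈ U.deRham ω' h q,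
      U.mode a (-1) b ∈ U.deRham ω' h (p + q)) ∧
    -- the scalar `ν`
    (∃ ν : ℂ, U.mode h 1 h = (ν / 2) • U.vac) ∧
    ∀ ν : ℂ, U.mode h 1 h = (ν / 2) • U.vac →
      -- (iii) `A^ν` is the least nonzero ideal of `V_0`, and it is one-dimensional
      IsLeast {I : Submodule ℂ V | U.IsZeroIdeal (U.shift ω' h) I ∧ I ≠ ⊥} (U.deRham ω' h ν) ∧
      (∃ t : V, t ≠ 0 ∧ U.deRham ω' h ν = Submodule.span ℂ {t}) ∧
      ∀ B : LinearMap.BilinForm ℂ V, B ≠ 0 → U.IsInvariant (U.shift ω' h) B →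
        -- (v)
        (∀ p q : ℂ, p + q ≠ ν → ∀ a ∈ U.deRham ω' h p, ∀ b ∈ U.deRham ω' h q, B a b = 0) ∧
        -- (vi)
        (∀ p q : ℂ, p + q = ν →
          (B.domRestrict₁₂ (U.deRham ω' h p) (U.deRham ω' h q)).IsPerfPair) := by
  refine ⟨fun v hv => hT.mode_zero_mem hv, hT.isVOA_W.deRham_eq_jointEigenspace,
    VertexAlgebra.iSupIndep_deRham, hT.iSup_deRham, fun p hp => hT.exists_nat_of_deRham_ne_bot hp,
    hT.deRham_zero, fun p q a ha b hb => hT.isVOA_V.mode_mem_deRham ha hb,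
    hT.exists_mode_one_self, fun ν hν => ⟨hT.isLeast_deRham hν,
      hT.exists_deRham_eq_span_singleton hν, fun B hB0 hB =>
        ⟨fun p q hpq a ha b hb => hT.apply_eq_zero_of_add_ne hν hB hpq ha hb,
          fun p q hpq => hT.isPerfPair_deRham hν hB hB0 hpq⟩⟩⟩
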